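/- For $\alpha<-1$ and $c>0$ let $\phi_{\alpha,c}(x)=(x^2+c^2)^{\alpha}$ for $x\in\mathbb{R}$, with Fourier transform $\widehat{\phi_{\alpha,c}}(\xi)=\int_{\mathbb{R}}\phi_{\alpha,c}(x)e^{-ix\xi}\,dx$. Define $$\widehat{L_{\alpha,c}}(\xi)=\frac{\widehat{\phi_{\alpha,c}}(\xi)}{\sum_{j\in\mathbb{Z}}\widehat{\phi_{\alpha,c}}(\xi+2\pi j)},\qquad L_{\alpha,c}(x)=\frac1{2\pi}\int_{\mathbb{R}}\widehat{L_{\alpha,c}}(\xi)e^{ix\xi}\,d\xi .$$ Theorem. Let $\alpha<-1$. (0) For every $c\ge 1$ and $\xi\in\mathbb{R}$ the series in the denominator converges absolutely and its sum is nonzero, so that $\widehat{L_{\alpha,c}}$ is well defined. (1) Let $k\ge 0$ be an integer with $k<2|\alpha|-1$. There is a constant $A_{\alpha,k}>0$, depending only on $\alpha$ and $k$, such that for every real $c\ge 1$ the function $\widehat{L_{\alpha,c}}$ is $k$ times continuously differentiable on $\mathbb{R}$ and $$\bigl\|\widehat{L_{\alpha,c}}^{(k)}\bigr\|_{L_1(\mathbb{R})}\le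 A_{\alpha,k}\,c^{(2k+1)(2|\alpha|-\lfloor|\alpha|\rfloor-1)+k}.$$ In particular (case $k=0$) $\widehat{L_{\alpha,c}}\in L_1(\mathbb{R})$, so $L_{\alpha,c}$ is well defined. (2) For every $c\ge 1$, $L_{\alpha,c}(x)=O\bigl(|x|^{-\lceil 2|\alpha|-2\rceil}\bigr)$ as $|x|\to\infty$. -/

import Mathlib

open MeasureTheory Filter Asymptotics

noncomputable section

/-- The univariate general multiquadric `φ_{α,c}(x) = (x² + c²)^α`. -/
def multiquadric (α c x : ℝ) : ℝ := (x ^ 2 + c ^ 2) ^ α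

/-- The Fourier transform `ξ ↦ ∫ φ_{α,c}(x) e^{-i ξ x} dx` of the multiquadric, with the
normalisation without `2π` in the exponent. It is used only for `α < -1` and `c > 0`, where
`φ_{α,c}` is integrable, so that the transform is given by this absolutely convergent integral. -/
def multiquadricHat (α c ξ : ℝ) : ℂ :=
  ∫ x : ℝ, (multiquadric α c x : ℂ) * Complex.exp (-(Complex.I * (ξ : ℂ) * (x : ℂ)))

/-- The Fourier transform of the fundamental function:
`φ̂_{α,c}(ξ) / ∑_{j ∈ ℤ} φ̂_{α,c}(ξ + 2πj)`. -/
def fundamentalHat (α c ξ : ℝ) : ℂ :=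
  multiquadricHat α c ξ / ∑' j : ℤ, multiquadricHat α c (ξ + 2 * Real.pi * (j : ℝ))

/-- The fundamental function
`L_{α,c}(x) = (2π)⁻¹ ∫ L̂_{α,c}(ξ) e^{i x ξ} dξ`. -/
def fundamentalFunction (α c x : ℝ) : ℂ :=
  (1 / (2 * (Real.pi : ℂ))) *
    ∫ ξ : ℝ, fundamentalHat α c ξ * Complex.exp (Complex.I * (x : ℂ) * (ξ : ℂ))

end

/-!
Write `β = -α > 1`. Up to a positive factor, which cancels in the quotient, the transform of the
multiquadric is `ξ ↦ B (c ξ)`, where `B x = ∫₀^∞ t^r e^{-t - x²/(4t)} dt` with `r = β - 3/2` is a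
Bessel-type integral (`multiquadricHat_one_eq_besselIntegral`, `multiquadricHat_eq_scale`); it is
positive and decays exponentially. The estimates rest on one property of `B`: for `m ≤ k < 2β - 1`,
`|B^{(m)}| ≤ C B` on the whole line.

* `B` is `C^k` because `|x|^m (x² + 1)^α` is integrable for `m ≤ k`, so on compact sets the property
  follows from the continuity of `B^{(m)}` and the positivity of `B`.
* On `(0, ∞)`, `B'' = B + ((2r+1)/x) B'`. Since `2r + 1 = 2β - 2 > 0`, the energy `B'² - B²` is
  nondecreasing; it vanishes at infinity, hence `|B'| ≤ B` (`abs_deriv_besselIntegral_le`). The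
  equation also writes `B^{(m)}` as a combination of `B` and `B'` with coefficients polynomial in
  `1/x`, which are bounded for `x ≥ 1` (`exists_derivsDominated_besselIntegral`).

Domination of derivatives passes to the sum of translates with the same constant
(`DerivsDominated.periodization`), and to quotients by the Leibniz rule with a constant that depends
only on `C` and `k` (`DerivsDominated.exists_div`). Undoing the dilation by `c`, the transform `F` of
the fundamental function satisfies `|F^{(k)}| ≤ K c^k F` with `K` independent of `c`. As the translates
of `F` by `2πj` add up to `1`, the integral of `F` is `2π` (`lintegral_div_periodization`). So the
`L¹` norm of `F^{(k)}` is at most `2π K c^k`, which is stronger than the stated bound because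
`2β - ⌊β⌋ - 1 ≥ 0` and `c ≥ 1`. Integrating by parts `⌈2β - 2⌉ < 2β - 1` times gives the decay.
-/

open Set Topology

/-! ### A Bessel-type integral -/

/-- The integral `∫₀^∞ t^r e^{-t - x²/(4t)} dt`, which for `x ≠ 0` equals
`2 (|x|/2)^{r+1} K_{r+1}(|x|)` with `K` the modified Bessel function of the second kind. It converges
for all real `r` if `x ≠ 0`, and for `r > -1` if `x = 0`. -/
noncomputable def besselIntegral (r x : ℝ) : ℝ :=
  ∫ t in Ioi (0 : ℝ), t ^ r * Real.exp (-t - x ^ 2 / (4 * t))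

theorem exp_neg_div_le {b t : ℝ} (hb : 0 < b) (ht : 0 < t) (n : ℕ) :
    Real.exp (-(b / t)) ≤ n.factorial / b ^ n * t ^ n := by
  have h := Real.pow_div_factorial_le_exp (b / t) (by positivity) n
  rw [Real.exp_neg, inv_le_comm₀ (Real.exp_pos _) (by positivity)]
  refine le_trans (le_of_eq ?_) h
  rw [div_pow]
  field_simp

theorem continuousOn_rpow_mul_exp_neg (r a b : ℝ) :
    ContinuousOn (fun t : ℝ => t ^ r * Real.exp (-(a * t) - b / t)) (Ioi 0) := by
  intro t ht
  have ht : t ≠ 0 := (mem_Ioi.1 ht).ne'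
  apply ContinuousAt.continuousWithinAt
  fun_prop (disch := simp [ht])

/-- The factor `e^{-b/t}` vanishes to infinite order at `0`, so no lower bound on `r` is needed. -/
theorem integrableOn_rpow_mul_exp_neg (r : ℝ) {a b : ℝ} (ha : 0 < a) (hb : 0 < b) :
    IntegrableOn (fun t : ℝ => t ^ r * Real.exp (-(a * t) - b / t)) (Ioi 0) := by
  obtain ⟨n, hn⟩ := exists_nat_gt (-1 - r)
  have h := (integrableOn_rpow_mul_exp_neg_mul_rpow (p := 1) (s := r + n) (b := a)
    (by linarith) one_pos ha).const_mul (n.factorial / b ^ n)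
  refine Integrable.mono' h
    ((continuousOn_rpow_mul_exp_neg r a b).aestronglyMeasurable measurableSet_Ioi) ?_
  filter_upwards [ae_restrict_mem measurableSet_Ioi] with t ht
  have ht : 0 < t := ht
  rw [Real.norm_of_nonneg (by positivity), Real.rpow_one, Real.rpow_add ht, Real.rpow_natCast,
    sub_eq_add_neg, Real.exp_add]
  have := exp_neg_div_le hb ht n
  calc t ^ r * (Real.exp (-(a * t)) * Real.exp (-(b / t)))
      ≤ t ^ r * (Real.exp (-(a * t)) * (n.factorial / b ^ n * t ^ n)) := by gcongr
    _ = _ := by rw [neg_mul]; ring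

theorem besselIntegrand_eq (r x t : ℝ) :
    t ^ r * Real.exp (-t - x ^ 2 / (4 * t)) =
      t ^ r * Real.exp (-(1 * t) - x ^ 2 / 4 / t) := by
  rw [one_mul, div_div]

theorem integrableOn_besselIntegrand (r : ℝ) {x : ℝ} (hx : x ≠ 0) :
    IntegrableOn (fun t : ℝ => t ^ r * Real.exp (-t - x ^ 2 / (4 * t))) (Ioi 0) := by
  simp only [besselIntegrand_eq]
  exact integrableOn_rpow_mul_exp_neg r one_pos (by positivity)

theorem integrableOn_besselIntegrand' {r : ℝ} (hr : -1 < r) (x : ℝ) :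
    IntegrableOn (fun t : ℝ => t ^ r * Real.exp (-t - x ^ 2 / (4 * t))) (Ioi 0) := by
  rcases eq_or_ne x 0 with rfl | hx
  · refine (integrableOn_rpow_mul_exp_neg_mul_rpow (p := 1) (b := 1) hr one_pos one_pos).congr_fun
      (fun t _ => by simp) measurableSet_Ioi
  · exact integrableOn_besselIntegrand r hx

theorem besselIntegral_neg (r x : ℝ) : besselIntegral r (-x) = besselIntegral r x := by
  simp [besselIntegral]

theorem besselIntegral_nonneg (r x : ℝ) : 0 ≤ besselIntegral r x :=
  setIntegral_nonneg measurableSet_Ioi fun t ht => by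
    have : 0 < t := ht
    positivity

theorem besselIntegral_pos {r : ℝ} (hr : -1 < r) (x : ℝ) : 0 < besselIntegral r x := by
  have hpos : ∀ t ∈ Ioi (0 : ℝ), 0 < t ^ r * Real.exp (-t - x ^ 2 / (4 * t)) := fun t ht => by
    have : 0 < t := ht
    positivity
  refine (setIntegral_pos_iff_support_of_nonneg_ae ?_ (integrableOn_besselIntegrand' hr x)).2 ?_
  · filter_upwards [ae_restrict_mem measurableSet_Ioi] with t ht using (hpos t ht).le
  · rw [inter_eq_right.2 (show Ioi (0 : ℝ) ⊆ Function.support _ from fun t ht => (hpos t ht).ne')]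
    simp

/-- Exponential decay, from `t + x²/(4t) ≥ |x|` applied to half of the exponent. -/
theorem exists_besselIntegral_le (r : ℝ) :
    ∃ C, 0 ≤ C ∧ ∀ x, 1 ≤ |x| → besselIntegral r x ≤ C * Real.exp (-(|x| / 2)) := by
  refine ⟨∫ t in Ioi (0 : ℝ), t ^ r * Real.exp (-(1 / 2 * t) - 1 / 8 / t),
    setIntegral_nonneg measurableSet_Ioi fun t ht => ?_, fun x hx => ?_⟩
  · have : 0 < t := ht
    positivity
  rw [besselIntegral, ← integral_mul_const]
  have hx0 : x ≠ 0 := by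
    rintro rfl
    norm_num at hx
  refine setIntegral_mono_on (integrableOn_besselIntegrand r hx0)
    ((integrableOn_rpow_mul_exp_neg r (by norm_num) (by norm_num)).mul_const _)
    measurableSet_Ioi fun t ht => ?_
  have ht : 0 < t := ht
  rw [mul_assoc, ← Real.exp_add]
  gcongr
  have h1 : 1 ≤ x ^ 2 := by nlinarith [sq_abs x]
  have h2 : |x| ≤ t + x ^ 2 / (4 * t) := by
    rw [← sub_nonneg]
    have : t + x ^ 2 / (4 * t) - |x| = (2 * t - |x|) ^ 2 / (4 * t) := by
      field_simp
      rw [← sq_abs x]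
      ring
    rw [this]
    positivity
  have h3 : 1 / (4 * t) ≤ x ^ 2 / (4 * t) := by gcongr
  have h4 : (1 : ℝ) / 8 / t = 1 / (4 * t) / 2 := by
    field_simp
    norm_num
  rw [h4]
  linarith

theorem hasDerivAt_besselIntegral (r : ℝ) {x : ℝ} (hx : 0 < x) :
    HasDerivAt (besselIntegral r) (-(x / 2) * besselIntegral (r - 1) x) x := by
  have key := hasDerivAt_integral_of_dominated_loc_of_deriv_le
    (μ := volume.restrict (Ioi (0 : ℝ))) (𝕜 := ℝ) (x₀ := x) (s := Ioo (x / 2) (2 * x))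
    (F := fun x t => t ^ r * Real.exp (-t - x ^ 2 / (4 * t)))
    (F' := fun x t => -(x / 2) * (t ^ (r - 1) * Real.exp (-t - x ^ 2 / (4 * t))))
    (bound := fun t => x * (t ^ (r - 1) * Real.exp (-t - (x / 2) ^ 2 / (4 * t))))
    (Ioo_mem_nhds (by linarith) (by linarith)) ?_ (integrableOn_besselIntegrand r hx.ne')
    ((integrableOn_besselIntegrand (r - 1) hx.ne').const_mul _).aestronglyMeasurable ?_
    ((integrableOn_besselIntegrand (r - 1) (by positivity)).const_mul _) ?_
  · have h := key.2
    rw [integral_const_mul] at h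
    exact h
  · filter_upwards [lt_mem_nhds hx] with y hy
    exact (integrableOn_besselIntegrand r hy.ne').aestronglyMeasurable
  · filter_upwards [ae_restrict_mem measurableSet_Ioi] with t ht y hy
    have ht : 0 < t := ht
    have hy0 : 0 < y := lt_trans (by positivity) hy.1
    rw [norm_mul, norm_neg, Real.norm_of_nonneg (by positivity), Real.norm_of_nonneg (by positivity)]
    have h1 : y / 2 ≤ x := by linarith [hy.2]
    have h2 : x / 2 ≤ y := hy.1.le
    gcongr
  · filter_upwards [ae_restrict_mem measurableSet_Ioi] with t ht y hy
    have ht : 0 < t := ht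
    have h1 : HasDerivAt (fun y : ℝ => -t - y ^ 2 / (4 * t)) (-(2 * y / (4 * t))) y := by
      simpa using ((hasDerivAt_pow 2 y).div_const (4 * t)).const_sub (-t)
    refine (h1.exp.const_mul (t ^ r)).congr_deriv ?_
    rw [Real.rpow_sub_one ht.ne']
    field_simp
    ring

/-- The three-term recurrence, obtained by integrating the derivative of `t^r e^{-t - x²/(4t)}`. -/
theorem besselIntegral_recurrence (r : ℝ) {x : ℝ} (hx : x ≠ 0) :
    besselIntegral r x = r * besselIntegral (r - 1) x + x ^ 2 / 4 * besselIntegral (r - 2) x := by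
  have hb : 0 < x ^ 2 / 4 := by positivity
  have hderiv : ∀ t ∈ Ioi (0 : ℝ), HasDerivAt (fun t : ℝ => Real.exp (-t - x ^ 2 / (4 * t)))
      (Real.exp (-t - x ^ 2 / (4 * t)) * (-1 + x ^ 2 / (4 * t ^ 2))) t := fun t ht => by
    have ht : 0 < t := ht
    have h := ((hasDerivAt_id t).neg.sub
      ((hasDerivAt_const t (x ^ 2 / 4)).div (hasDerivAt_id t) ht.ne')).exp
    refine (h.congr_deriv ?_).congr_of_eventuallyEq (.of_forall fun s => ?_)
    · simp only [id, Pi.sub_apply, Pi.neg_apply, Pi.div_apply, div_div]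
      congr 1
      field_simp
      ring
    · simp [div_div]
  have hint := ((integrableOn_besselIntegrand (r - 1) hx).const_mul r).sub
    (integrableOn_besselIntegrand r hx) |>.add
    ((integrableOn_besselIntegrand (r - 2) hx).const_mul (x ^ 2 / 4))
  have heq : ∀ t ∈ Ioi (0 : ℝ),
      r * (t ^ (r - 1) * Real.exp (-t - x ^ 2 / (4 * t))) -
        t ^ r * Real.exp (-t - x ^ 2 / (4 * t)) +
        x ^ 2 / 4 * (t ^ (r - 2) * Real.exp (-t - x ^ 2 / (4 * t))) =
      r * t ^ (r - 1) * Real.exp (-t - x ^ 2 / (4 * t)) +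
        t ^ r * (Real.exp (-t - x ^ 2 / (4 * t)) * (-1 + x ^ 2 / (4 * t ^ 2))) := fun t ht => by
    have ht : 0 < t := ht
    have : t ^ (r - 2) = t ^ r / t ^ 2 := by
      rw [Real.rpow_sub ht]
      norm_num
    rw [this]
    field_simp
    ring
  have h0 : Tendsto ((fun t : ℝ => t ^ r) * fun t : ℝ => Real.exp (-t - x ^ 2 / (4 * t)))
      (𝓝[>] 0) (𝓝 0) := by
    obtain ⟨n, hn⟩ := exists_nat_gt (-r)
    have hlim : Tendsto (fun t : ℝ => n.factorial / (x ^ 2 / 4) ^ n * t ^ (r + n)) (𝓝[>] 0)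
        (𝓝 0) := by
      have : Tendsto (fun t : ℝ => n.factorial / (x ^ 2 / 4) ^ n * t ^ (r + n)) (𝓝 0)
          (𝓝 (n.factorial / (x ^ 2 / 4) ^ n * (0 : ℝ) ^ (r + n))) :=
        ((Real.continuousAt_rpow_const 0 (r + n) (Or.inr (by linarith))).const_mul _)
      rw [Real.zero_rpow (by linarith), mul_zero] at this
      exact this.mono_left nhdsWithin_le_nhds
    refine squeeze_zero' ?_ ?_ hlim
    · filter_upwards [self_mem_nhdsWithin] with t ht
      have ht : 0 < t := ht
      simp only [Pi.mul_apply]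
      positivity
    · filter_upwards [self_mem_nhdsWithin] with t ht
      have ht : 0 < t := ht
      rw [Real.rpow_add ht, Real.rpow_natCast]
      calc t ^ r * Real.exp (-t - x ^ 2 / (4 * t))
          ≤ t ^ r * Real.exp (-(x ^ 2 / 4 / t)) := by
            gcongr
            rw [div_div]
            linarith
        _ ≤ t ^ r * (n.factorial / (x ^ 2 / 4) ^ n * t ^ n) := by
            gcongr
            exact exp_neg_div_le hb ht n
        _ = _ := by ring
  have htop : Tendsto ((fun t : ℝ => t ^ r) * fun t : ℝ => Real.exp (-t - x ^ 2 / (4 * t)))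
      atTop (𝓝 0) := by
    refine squeeze_zero' ?_ ?_ (tendsto_rpow_mul_exp_neg_mul_atTop_nhds_zero r 1 one_pos)
    · filter_upwards [eventually_gt_atTop 0] with t ht
      simp only [Pi.mul_apply]
      positivity
    · filter_upwards [eventually_gt_atTop 0] with t ht
      simp only [Pi.mul_apply]
      gcongr
      have : 0 ≤ x ^ 2 / (4 * t) := by positivity
      linarith
  have hibp := integral_Ioi_deriv_mul_eq_sub
    (u' := fun t : ℝ => r * t ^ (r - 1))
    (fun t ht => Real.hasDerivAt_rpow_const (Or.inl (mem_Ioi.1 ht).ne')) hderiv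
    (IntegrableOn.congr_fun hint heq measurableSet_Ioi) h0 htop
  rw [← setIntegral_congr_fun measurableSet_Ioi heq, sub_self] at hibp
  have hsplit : ∫ t in Ioi (0 : ℝ), (r * (t ^ (r - 1) * Real.exp (-t - x ^ 2 / (4 * t))) -
        t ^ r * Real.exp (-t - x ^ 2 / (4 * t)) +
        x ^ 2 / 4 * (t ^ (r - 2) * Real.exp (-t - x ^ 2 / (4 * t)))) =
      r * besselIntegral (r - 1) x - besselIntegral r x +
        x ^ 2 / 4 * besselIntegral (r - 2) x := by
    simp only [besselIntegral]
    rw [integral_add, integral_sub, integral_const_mul, integral_const_mul]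
    · exact (integrableOn_besselIntegrand (r - 1) hx).const_mul r
    · exact integrableOn_besselIntegrand r hx
    · exact ((integrableOn_besselIntegrand (r - 1) hx).const_mul r).sub
        (integrableOn_besselIntegrand r hx)
    · exact (integrableOn_besselIntegrand (r - 2) hx).const_mul (x ^ 2 / 4)
  linarith

/-! ### The differential equation of the Bessel-type integral -/

/-- The differential equation `B'' = B + ((2r+1)/x) B'` of `B = besselIntegral r` on `(0, ∞)`,
as the derivative of `B'`. -/
theorem hasDerivAt_deriv_besselIntegral (r : ℝ) {x : ℝ} (hx : 0 < x) :
    HasDerivAt (fun y => -(y / 2) * besselIntegral (r - 1) y)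
      (besselIntegral r x + (2 * r + 1) * x⁻¹ * (-(x / 2) * besselIntegral (r - 1) x)) x := by
  have h := (((hasDerivAt_id x).div_const 2).neg).mul (hasDerivAt_besselIntegral (r - 1) hx)
  refine h.congr_deriv ?_
  have hrec := besselIntegral_recurrence r hx.ne'
  rw [show r - 1 - 1 = r - 2 by ring, hrec]
  simp only [Pi.neg_apply, id]
  field_simp
  ring

/-- For `r > -1/2` the energy `B'² - B²` of `B = besselIntegral r` is nondecreasing on `(0, ∞)`, as
its derivative is `2 (2r+1) B'² / x`, and it tends to `0` at infinity; hence `|B'| ≤ B`. -/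
theorem abs_deriv_besselIntegral_le {r : ℝ} (hr : -(1 / 2) < r) {x : ℝ} (hx : 0 < x) :
    |-(x / 2) * besselIntegral (r - 1) x| ≤ besselIntegral r x := by
  set B := besselIntegral r
  set D : ℝ → ℝ := fun y => -(y / 2) * besselIntegral (r - 1) y with hD
  have hE : ∀ y, 0 < y → HasDerivAt (fun y => D y ^ 2 - B y ^ 2)
      (2 * (2 * r + 1) * y⁻¹ * D y ^ 2) y := fun y hy => by
    refine (((hasDerivAt_deriv_besselIntegral r hy).pow 2).sub
      ((hasDerivAt_besselIntegral r hy).pow 2)).congr_deriv ?_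
    simp only [hD]
    push_cast
    ring
  have hmono : MonotoneOn (fun y => D y ^ 2 - B y ^ 2) (Ioi 0) := by
    refine monotoneOn_of_deriv_nonneg (convex_Ioi 0)
      (fun y hy => (hE y hy).continuousAt.continuousWithinAt) ?_ ?_
    · intro y hy
      rw [interior_Ioi] at hy
      exact (hE y hy).differentiableAt.differentiableWithinAt
    · intro y hy
      rw [interior_Ioi] at hy
      have hy : 0 < y := hy
      rw [(hE y hy).deriv]
      have : 0 < 2 * r + 1 := by linarith
      positivity
  have hDlim : Tendsto D atTop (𝓝 0) := by
    obtain ⟨C, hC, h⟩ := exists_besselIntegral_le (r - 1)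
    have hlim : Tendsto (fun y : ℝ => C / 2 * (y ^ (1 : ℝ) * Real.exp (-(1 / 2) * y))) atTop
        (𝓝 0) := by
      simpa using (tendsto_rpow_mul_exp_neg_mul_atTop_nhds_zero 1 (1 / 2)
        (by norm_num)).const_mul (C / 2)
    refine squeeze_zero_norm' ?_ hlim
    filter_upwards [eventually_ge_atTop 1] with y hy
    have hy0 : 0 < y := by linarith
    have := h y (by rwa [abs_of_pos hy0])
    rw [abs_of_pos hy0] at this
    rw [hD, norm_mul, norm_neg, Real.norm_of_nonneg (by positivity),
      Real.norm_of_nonneg (besselIntegral_nonneg _ _), Real.rpow_one]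
    calc y / 2 * besselIntegral (r - 1) y ≤ y / 2 * (C * Real.exp (-(y / 2))) := by gcongr
      _ = _ := by rw [show -(1 / 2) * y = -(y / 2) by ring]; ring
  have hElim : Tendsto (fun y => D y ^ 2) atTop (𝓝 0) := by simpa using hDlim.pow 2
  have hle : D x ^ 2 - B x ^ 2 ≤ 0 := by
    refine ge_of_tendsto hElim ?_
    filter_upwards [eventually_ge_atTop x] with y hy
    have h1 : D x ^ 2 - B x ^ 2 ≤ D y ^ 2 - B y ^ 2 :=
      hmono hx (mem_Ioi.2 (hx.trans_le hy)) hy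
    linarith [sq_nonneg (B y)]
  exact abs_le_of_sq_le_sq (sub_nonpos.1 hle) (besselIntegral_nonneg r x)

open Polynomial in
/-- By the differential equation, every derivative of `B = besselIntegral r` on `(0, ∞)` is a
combination of `B` and `B'` whose coefficients are polynomials in `1/x`. -/
theorem exists_iteratedDeriv_besselIntegral_eq (r : ℝ) (m : ℕ) :
    ∃ p q : ℝ[X], ∀ x, 0 < x → iteratedDeriv m (besselIntegral r) x =
      p.eval x⁻¹ * besselIntegral r x +
        q.eval x⁻¹ * (-(x / 2) * besselIntegral (r - 1) x) := by
  induction m with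
  | zero => exact ⟨1, 0, fun x _ => by simp⟩
  | succ m ih =>
    obtain ⟨p, q, h⟩ := ih
    refine ⟨-X ^ 2 * derivative p + q, p - X ^ 2 * derivative q + C (2 * r + 1) * X * q,
      fun x hx => ?_⟩
    have heval : ∀ p : ℝ[X], HasDerivAt (fun y : ℝ => p.eval y⁻¹)
        ((derivative p).eval x⁻¹ * -(x ^ 2)⁻¹) x := fun p =>
      (p.hasDerivAt x⁻¹).comp x (hasDerivAt_inv hx.ne')
    have hd := ((heval p).mul (hasDerivAt_besselIntegral r hx)).add
      ((heval q).mul (hasDerivAt_deriv_besselIntegral r hx))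
    rw [iteratedDeriv_succ]
    refine HasDerivAt.deriv ?_
    refine (hd.congr_of_eventuallyEq ?_).congr_deriv ?_
    · filter_upwards [lt_mem_nhds hx] with y hy using h y hy
    · simp only [eval_add, eval_mul, eval_neg, eval_pow, eval_X, eval_sub, eval_C, inv_pow]
      ring

/-- A function with `|f^{(m)}| ≤ C f` for every `m ≤ n`, with one constant `C`. -/
def DerivsDominated (n : ℕ) (C : ℝ) (f : ℝ → ℝ) : Prop :=
  ∀ m ≤ n, ∀ x, |iteratedDeriv m f x| ≤ C * f x

open Polynomial in
theorem exists_abs_eval_inv_le (p : ℝ[X]) : ∃ C, ∀ x : ℝ, 1 ≤ x → |p.eval x⁻¹| ≤ C := by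
  obtain ⟨C, hC⟩ := isCompact_Icc.exists_bound_of_continuousOn (s := Icc (0 : ℝ) 1)
    p.continuous.continuousOn
  exact ⟨C, fun x hx => hC _ ⟨by positivity, inv_le_one_of_one_le₀ hx⟩⟩

/-- Near `0` the bound holds by compactness, and for `|x| ≥ 1` it comes from the differential
equation and `|B'| ≤ B`. -/
theorem exists_abs_iteratedDeriv_besselIntegral_le {r : ℝ} (hr : -(1 / 2) < r) {n m : ℕ}
    (hm : m ≤ n) (hB : ContDiff ℝ n (besselIntegral r)) :
    ∃ C, ∀ x, |iteratedDeriv m (besselIntegral r) x| ≤ C * besselIntegral r x := by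
  have hpos := besselIntegral_pos (show -1 < r by linarith)
  obtain ⟨p, q, hpq⟩ := exists_iteratedDeriv_besselIntegral_eq r m
  obtain ⟨P, hP⟩ := exists_abs_eval_inv_le p
  obtain ⟨Q, hQ⟩ := exists_abs_eval_inv_le q
  obtain ⟨C, hC⟩ := isCompact_Icc.exists_bound_of_continuousOn (s := Icc (-1 : ℝ) 1)
    (f := fun x => iteratedDeriv m (besselIntegral r) x / besselIntegral r x)
    ((hB.continuous_iteratedDeriv m (by exact_mod_cast hm)).div hB.continuous
      fun x => (hpos x).ne').continuousOn
  have hfar : ∀ x, 1 ≤ x →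
      |iteratedDeriv m (besselIntegral r) x| ≤ (P + Q) * besselIntegral r x := fun x hx => by
    have hx0 : 0 < x := by linarith
    rw [hpq x hx0, add_mul]
    refine (abs_add_le _ _).trans (add_le_add ?_ ?_)
    · rw [abs_mul, abs_of_pos (hpos x)]
      exact mul_le_mul_of_nonneg_right (hP x hx) (hpos x).le
    · rw [abs_mul]
      exact mul_le_mul (hQ x hx) (abs_deriv_besselIntegral_le hr hx0) (abs_nonneg _)
        ((abs_nonneg _).trans (hQ x hx))
  have heven : ∀ x, |iteratedDeriv m (besselIntegral r) (-x)| =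
      |iteratedDeriv m (besselIntegral r) x| := fun x => by
    have h := iteratedDeriv_comp_neg m (besselIntegral r) x
    simp only [besselIntegral_neg] at h
    have h' : |iteratedDeriv m (besselIntegral r) x| =
        |(-1 : ℝ) ^ m • iteratedDeriv m (besselIntegral r) (-x)| := by rw [← h]
    rw [h', smul_eq_mul, abs_mul, abs_pow, abs_neg, abs_one, one_pow, one_mul]
  refine ⟨max C (P + Q), fun x => ?_⟩
  by_cases hx : x ∈ Icc (-1 : ℝ) 1
  · have := hC x hx
    rw [norm_div, Real.norm_eq_abs, Real.norm_of_nonneg (hpos x).le, div_le_iff₀ (hpos x)] at this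
    exact this.trans (mul_le_mul_of_nonneg_right (le_max_left _ _) (hpos x).le)
  · have hfar' : |iteratedDeriv m (besselIntegral r) x| ≤ (P + Q) * besselIntegral r x := by
      rcases le_or_gt 1 x with h1 | h1
      · exact hfar x h1
      · rw [← heven, ← besselIntegral_neg]
        refine hfar (-x) ?_
        by_contra h2
        exact hx ⟨by linarith, h1.le⟩
    exact hfar'.trans (mul_le_mul_of_nonneg_right (le_max_right _ _) (hpos x).le)

theorem exists_derivsDominated_besselIntegral {r : ℝ} (hr : -(1 / 2) < r) {n : ℕ}
    (hB : ContDiff ℝ n (besselIntegral r)) :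
    ∃ C, DerivsDominated n C (besselIntegral r) := by
  have hpos := besselIntegral_pos (show -1 < r by linarith)
  have h : ∀ m, ∃ C, m ≤ n → ∀ x,
      |iteratedDeriv m (besselIntegral r) x| ≤ C * besselIntegral r x := fun m => by
    by_cases hm : m ≤ n
    · obtain ⟨C, hC⟩ := exists_abs_iteratedDeriv_besselIntegral_le hr hm hB
      exact ⟨C, fun _ => hC⟩
    · exact ⟨0, fun h => absurd h hm⟩
  choose C hC using h
  refine ⟨∑ m ∈ Finset.range (n + 1), |C m|, fun m hm x => (hC m hm x).trans ?_⟩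
  refine mul_le_mul_of_nonneg_right ((le_abs_self _).trans ?_) (hpos x).le
  exact Finset.single_le_sum (f := fun m => |C m|) (fun _ _ => abs_nonneg _)
    (Finset.mem_range.2 (by omega))

/-- The global form of the exponential decay. -/
theorem exists_besselIntegral_le_exp {r : ℝ} (hB : Continuous (besselIntegral r)) :
    ∃ C, 0 ≤ C ∧ ∀ x, besselIntegral r x ≤ C * Real.exp (-(|x| / 2)) := by
  obtain ⟨C, hC0, hC⟩ := exists_besselIntegral_le r
  obtain ⟨M, hM⟩ := isCompact_Icc.exists_bound_of_continuousOn (s := Icc (-1 : ℝ) 1)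
    hB.continuousOn
  refine ⟨max C (M * Real.exp (1 / 2)), le_max_of_le_left hC0, fun x => ?_⟩
  rcases le_or_gt 1 |x| with hx | hx
  · exact (hC x hx).trans (mul_le_mul_of_nonneg_right (le_max_left _ _) (Real.exp_pos _).le)
  · have h1 := (le_abs_self _).trans (hM x (abs_le.1 hx.le))
    have hM0 : 0 ≤ M := (besselIntegral_nonneg r x).trans h1
    refine le_trans ?_ (mul_le_mul_of_nonneg_right (le_max_right _ _) (Real.exp_pos _).le)
    rw [mul_assoc, ← Real.exp_add]
    exact h1.trans (le_mul_of_one_le_right hM0 (Real.one_le_exp (by linarith)))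

/-! ### Quotients of functions that dominate their derivatives -/

/-- The constant depends on `n` and `C` only. By the Leibniz rule applied to `f = (f / g) g`, the top
derivative of `f / g` is controlled by the lower ones. -/
theorem DerivsDominated.exists_div (n : ℕ) (C : ℝ) :
    ∃ K, 0 ≤ K ∧ ∀ f g : ℝ → ℝ, ContDiff ℝ n f → ContDiff ℝ n g → (∀ x, 0 < f x) →
      (∀ x, 0 < g x) → DerivsDominated n C f → DerivsDominated n C g →
      DerivsDominated n K (fun x => f x / g x) := by
  induction n with
  | zero =>
    refine ⟨1, zero_le_one, fun f g _ _ hf hg _ _ m hm x => ?_⟩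
    obtain rfl : m = 0 := by omega
    rw [iteratedDeriv_zero, one_mul, abs_of_pos (div_pos (hf x) (hg x))]
  | succ n ih =>
    obtain ⟨K, hK, h⟩ := ih
    set K' : ℝ := C + ∑ i ∈ Finset.range (n + 1), ((n + 1).choose i : ℝ) * K * C with hK'
    refine ⟨max K K', le_max_of_le_left hK, fun f g hf hg hf0 hg0 hfC hgC m hm x => ?_⟩
    have hn : (n : WithTop ℕ∞) ≤ ((n + 1 : ℕ) : WithTop ℕ∞) := by exact_mod_cast n.le_succ
    have hquot : 0 < f x / g x := div_pos (hf0 x) (hg0 x)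
    have hlow : DerivsDominated n K (fun x => f x / g x) :=
      h f g (hf.of_le hn) (hg.of_le hn) hf0 hg0 (fun m hm => hfC m (by omega))
        (fun m hm => hgC m (by omega))
    rcases Nat.lt_or_ge n m with hnm | hnm
    swap
    · exact (hlow m hnm x).trans (mul_le_mul_of_nonneg_right (le_max_left _ _) hquot.le)
    obtain rfl : m = n + 1 := by omega
    refine le_trans ?_ (mul_le_mul_of_nonneg_right (le_max_right _ _) hquot.le)
    have hq : ContDiff ℝ ((n + 1 : ℕ) : WithTop ℕ∞) (fun x => f x / g x) :=
      hf.div hg fun x => (hg0 x).ne'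
    have hleib := iteratedDeriv_fun_mul (hq.contDiffAt (x := x)) (hg.contDiffAt (x := x))
    have hfg : (fun x => f x / g x * g x) = f := funext fun x => div_mul_cancel₀ _ (hg0 x).ne'
    rw [hfg, Finset.sum_range_succ, Nat.choose_self, Nat.sub_self, iteratedDeriv_zero,
      Nat.cast_one, one_mul] at hleib
    rw [← mul_le_mul_iff_left₀ (hg0 x)]
    have hsum : |∑ i ∈ Finset.range (n + 1), ((n + 1).choose i : ℝ) *
        iteratedDeriv i (fun x => f x / g x) x * iteratedDeriv (n + 1 - i) g x| ≤
        ∑ i ∈ Finset.range (n + 1), ((n + 1).choose i : ℝ) * K * C * f x := by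
      refine (Finset.abs_sum_le_sum_abs _ _).trans (Finset.sum_le_sum fun i hi => ?_)
      have hi : i ≤ n := Nat.lt_succ_iff.1 (Finset.mem_range.1 hi)
      rw [abs_mul, abs_mul, Nat.abs_cast]
      calc ((n + 1).choose i : ℝ) * |iteratedDeriv i (fun x => f x / g x) x| *
            |iteratedDeriv (n + 1 - i) g x|
          ≤ ((n + 1).choose i : ℝ) * (K * (f x / g x)) * (C * g x) := by
            gcongr
            · exact hlow i hi x
            · exact hgC _ (by omega) x
        _ = ((n + 1).choose i : ℝ) * K * C * (f x / g x * g x) := by ring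
        _ = _ := by rw [div_mul_cancel₀ _ (hg0 x).ne']
    have htop := hfC (n + 1) le_rfl x
    rw [← Finset.sum_mul] at hsum
    calc |iteratedDeriv (n + 1) (fun x => f x / g x) x| * g x
        = |iteratedDeriv (n + 1) (fun x => f x / g x) x * g x| := by
          rw [abs_mul, abs_of_pos (hg0 x)]
      _ = |iteratedDeriv (n + 1) f x - ∑ i ∈ Finset.range (n + 1), ((n + 1).choose i : ℝ) *
            iteratedDeriv i (fun x => f x / g x) x * iteratedDeriv (n + 1 - i) g x| := by
          rw [hleib]
          congr 1
          ring
      _ ≤ C * f x + (∑ i ∈ Finset.range (n + 1), ((n + 1).choose i : ℝ) * K * C) * f x :=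
          (abs_sub _ _).trans (add_le_add htop hsum)
      _ = K' * (f x / g x * g x) := by rw [div_mul_cancel₀ _ (hg0 x).ne', hK', add_mul]
      _ = _ := by ring

/-! ### Periodization -/

/-- The periodization `y ↦ ∑_{j ∈ ℤ} f (y + P j)`. -/
noncomputable def periodization (P : ℝ) (f : ℝ → ℝ) (y : ℝ) : ℝ := ∑' j : ℤ, f (y + P * j)

theorem summable_exp_neg_mul_abs_int {a : ℝ} (ha : 0 < a) :
    Summable fun j : ℤ => Real.exp (-(a * |(j : ℝ)|)) := by
  have h : Summable fun n : ℕ => Real.exp (-(a * n)) := by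
    have := Real.summable_exp_nat_mul_iff.2 (neg_lt_zero.2 ha)
    refine this.congr fun n => by ring_nf
  refine Summable.of_nat_of_neg (by simpa using h) (by simpa using h)

theorem exp_neg_abs_add_le {P R y : ℝ} (hP : 0 < P) (hy : |y| ≤ R) (j : ℤ) :
    Real.exp (-(|y + P * j| / 2)) ≤ Real.exp (R / 2) * Real.exp (-(P / 2 * |(j : ℝ)|)) := by
  rw [← Real.exp_add]
  gcongr
  have h := abs_sub_abs_le_abs_sub (P * (j : ℝ)) (-y)
  rw [abs_mul, abs_of_pos hP, abs_neg, sub_neg_eq_add, add_comm (P * (j : ℝ))] at h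
  linarith

section Periodization

variable {n : ℕ} {C D P : ℝ} {f : ℝ → ℝ}

/-- A summable majorant, uniform on `[-R, R]`, of the series of `m`-th derivatives. -/
theorem DerivsDominated.norm_translate_le (hC : 0 ≤ C) (hP : 0 < P) (hfC : DerivsDominated n C f)
    (hfD : ∀ x, f x ≤ D * Real.exp (-(|x| / 2))) (hD : 0 ≤ D) {m : ℕ} (hm : m ≤ n) {R y : ℝ}
    (hy : |y| ≤ R) (j : ℤ) :
    ‖iteratedDeriv m f (y + P * j)‖ ≤
      C * D * Real.exp (R / 2) * Real.exp (-(P / 2 * |(j : ℝ)|)) := by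
  have h := exp_neg_abs_add_le hP hy j
  calc ‖iteratedDeriv m f (y + P * j)‖ ≤ C * f (y + P * j) := hfC m hm _
    _ ≤ C * (D * Real.exp (-(|y + P * j| / 2))) := by gcongr; exact hfD _
    _ ≤ C * (D * (Real.exp (R / 2) * Real.exp (-(P / 2 * |(j : ℝ)|)))) := by gcongr
    _ = _ := by ring

theorem DerivsDominated.summable_majorant (hP : 0 < P) (R : ℝ) :
    Summable fun j : ℤ => C * D * Real.exp (R / 2) * Real.exp (-(P / 2 * |(j : ℝ)|)) :=
  (summable_exp_neg_mul_abs_int (half_pos hP)).mul_left _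

theorem DerivsDominated.summable_translate (hC : 0 ≤ C) (hP : 0 < P) (hfC : DerivsDominated n C f)
    (hfD : ∀ x, f x ≤ D * Real.exp (-(|x| / 2))) (hD : 0 ≤ D) {m : ℕ} (hm : m ≤ n) (y : ℝ) :
    Summable fun j : ℤ => iteratedDeriv m f (y + P * j) :=
  Summable.of_norm_bounded (summable_majorant hP |y|) fun j =>
    hfC.norm_translate_le hC hP hfD hD hm le_rfl j

theorem DerivsDominated.iteratedDeriv_periodization (hC : 0 ≤ C) (hP : 0 < P)
    (hf : ContDiff ℝ n f) (hfC : DerivsDominated n C f)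
    (hfD : ∀ x, f x ≤ D * Real.exp (-(|x| / 2))) (hD : 0 ≤ D) {m : ℕ} (hm : m ≤ n) :
    iteratedDeriv m (periodization P f) = periodization P (iteratedDeriv m f) ∧
      (m < n → Differentiable ℝ (iteratedDeriv m (periodization P f))) := by
  have hderiv : ∀ m < n, ∀ y, HasDerivAt (periodization P (iteratedDeriv m f))
      (periodization P (iteratedDeriv (m + 1) f) y) y := fun m hm y => by
    have hball : ∀ z ∈ Metric.ball (0 : ℝ) (|y| + 1), |z| ≤ |y| + 1 := fun z hz => by
      simpa using (mem_ball_zero_iff.1 hz).le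
    refine hasDerivAt_tsum_of_isPreconnected (summable_majorant (C := C) (D := D) hP (|y| + 1))
      Metric.isOpen_ball (convex_ball (0 : ℝ) (|y| + 1)).isPreconnected
      (fun j z _ => ?_) (fun j z hz => hfC.norm_translate_le hC hP hfD hD hm (hball z hz) j)
      (y₀ := y) (by simp) (hfC.summable_translate hC hP hfD hD hm.le y) (by simp)
    have h := (hf.differentiable_iteratedDeriv m (by exact_mod_cast hm) (z + P * j)).hasDerivAt
    rw [← iteratedDeriv_succ] at h
    exact h.comp_add_const z (P * j)
  have hiter : iteratedDeriv m (periodization P f) = periodization P (iteratedDeriv m f) := by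
    induction m with
    | zero => simp
    | succ m ih =>
      rw [iteratedDeriv_succ, ih (by omega)]
      exact funext fun y => (hderiv m hm y).deriv
  exact ⟨hiter, fun hmn => hiter ▸ fun y => (hderiv m hmn y).differentiableAt⟩

theorem DerivsDominated.contDiff_periodization (hC : 0 ≤ C) (hP : 0 < P)
    (hf : ContDiff ℝ n f) (hfC : DerivsDominated n C f)
    (hfD : ∀ x, f x ≤ D * Real.exp (-(|x| / 2))) (hD : 0 ≤ D) :
    ContDiff ℝ n (periodization P f) := by
  have key := fun m hm => hfC.iteratedDeriv_periodization hC hP hf hfD hD (m := m) hm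
  refine (contDiff_nat_iff_iteratedDeriv).2 ⟨fun m hm => ?_, fun m hm => (key m hm.le).2 hm⟩
  rw [(key m hm).1]
  refine continuous_iff_continuousAt.2 fun y => ?_
  refine ContinuousOn.continuousAt (s := Metric.ball 0 (|y| + 1))
    (continuousOn_tsum (fun j => ?_) (summable_majorant (C := C) (D := D) hP (|y| + 1))
      fun j z hz => hfC.norm_translate_le hC hP hfD hD hm ?_ j)
    (Metric.isOpen_ball.mem_nhds (by simp))
  · exact ((hf.continuous_iteratedDeriv m (by exact_mod_cast hm)).comp
      (continuous_id.add continuous_const)).continuousOn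
  · simpa using (mem_ball_zero_iff.1 hz).le

theorem DerivsDominated.periodization (hC : 0 ≤ C) (hP : 0 < P)
    (hf : ContDiff ℝ n f) (hfC : DerivsDominated n C f)
    (hfD : ∀ x, f x ≤ D * Real.exp (-(|x| / 2))) (hD : 0 ≤ D) :
    DerivsDominated n C (periodization P f) := fun m hm y => by
  rw [(hfC.iteratedDeriv_periodization hC hP hf hfD hD hm).1, ← Real.norm_eq_abs]
  have hs := hfC.summable_translate hC hP hfD hD (Nat.zero_le n) y
  simp only [iteratedDeriv_zero] at hs
  refine tsum_of_norm_bounded (hs.hasSum.mul_left C) fun j => hfC m hm _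

end Periodization

theorem periodization_add_zsmul (P : ℝ) (f : ℝ → ℝ) (y : ℝ) (i : ℤ) :
    periodization P f (y + P * i) = periodization P f y := by
  rw [periodization, periodization, ← (Equiv.addLeft i).tsum_eq fun j : ℤ => f (y + P * j)]
  congr 1 with j
  simp only [Equiv.coe_addLeft]
  push_cast
  ring_nf

theorem lintegral_eq_tsum_translate {P : ℝ} (hP : 0 < P) (F : ℝ → ENNReal) :
    ∫⁻ x, F x = ∑' j : ℤ, ∫⁻ x in Ioc 0 P, F (x + P * j) := by
  have h := (isAddFundamentalDomain_Ioc hP 0 volume).lintegral_eq_tsum'' F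
  have hinj : Function.Injective fun j : ℤ => j • P := fun i j hij => by
    simpa [hP.ne'] using hij
  let e : ℤ ≃ AddSubgroup.zmultiples P := Equiv.ofInjective _ hinj
  rw [h, zero_add, ← e.tsum_eq]
  refine tsum_congr fun j => lintegral_congr fun x => congrArg F ?_
  change j • P + x = _
  rw [zsmul_eq_mul]
  ring

/-- The translates of `f / periodization P f` by multiples of `P` add up to `1`, so its integral is
the length of one period. -/
theorem lintegral_div_periodization {P : ℝ} (hP : 0 < P) {f : ℝ → ℝ} (hf : Continuous f)
    (hS : Continuous (periodization P f)) (hf0 : ∀ x, 0 < f x)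
    (hsum : ∀ y, Summable fun j : ℤ => f (y + P * j)) :
    ∫⁻ x, ENNReal.ofReal (f x / periodization P f x) = ENNReal.ofReal P := by
  have hS0 : ∀ y, 0 < periodization P f y := fun y =>
    (hsum y).tsum_pos (fun j => (hf0 _).le) 0 (hf0 _)
  rw [lintegral_eq_tsum_translate hP, ← lintegral_tsum]
  · have : ∀ x, ∑' j : ℤ, ENNReal.ofReal
        (f (x + P * j) / periodization P f (x + P * j)) = 1 := fun x => by
      simp only [periodization_add_zsmul]
      rw [← ENNReal.ofReal_tsum_of_nonneg (fun j => (div_pos (hf0 _) (hS0 x)).le)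
        ((hsum x).div_const _), tsum_div_const]
      rw [← periodization, div_self (hS0 x).ne', ENNReal.ofReal_one]
    simp [this]
  · intro j
    have : Continuous fun x => f x / periodization P f x :=
      hf.div hS fun x => (hS0 x).ne'
    fun_prop

/-! ### The Fourier transform of the multiquadric -/

theorem integrable_pow_mul_multiquadric {α : ℝ} {n : ℕ} (hn : (n : ℝ) < 2 * -α - 1) :
    Integrable fun x : ℝ => ‖x‖ ^ n * ‖(multiquadric α 1 x : ℂ)‖ := by
  have hint : Integrable fun x : ℝ => (1 + ‖x‖ ^ 2) ^ (-(2 * -α - n) / 2) :=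
    integrable_rpow_neg_one_add_norm_sq (by simp; linarith)
  refine hint.mono' ?_ (.of_forall fun x => ?_)
  · refine Continuous.aestronglyMeasurable ?_
    have : Continuous (multiquadric α 1) :=
      Continuous.rpow_const (by fun_prop) fun x => Or.inl (by positivity)
    fun_prop
  · have hpos : 0 < 1 + ‖x‖ ^ 2 := by positivity
    have h1 : ‖x‖ ^ n ≤ (1 + ‖x‖ ^ 2) ^ ((n : ℝ) / 2) := by
      calc ‖x‖ ^ n = (‖x‖ ^ 2) ^ ((n : ℝ) / 2) := by
            rw [← Real.rpow_natCast (‖x‖) 2, ← Real.rpow_mul (norm_nonneg x), ← Real.rpow_natCast]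
            congr 1
            push_cast
            ring
        _ ≤ _ := by gcongr; linarith
    have h2 : ‖(multiquadric α 1 x : ℂ)‖ = (1 + ‖x‖ ^ 2) ^ α := by
      rw [Complex.norm_real, multiquadric, Real.norm_of_nonneg (by positivity), Real.norm_eq_abs,
        sq_abs]
      ring_nf
    refine (Real.norm_of_nonneg (by positivity)).le.trans ?_
    rw [h2]
    calc ‖x‖ ^ n * (1 + ‖x‖ ^ 2) ^ α
        ≤ (1 + ‖x‖ ^ 2) ^ ((n : ℝ) / 2) * (1 + ‖x‖ ^ 2) ^ α := by gcongr
      _ = _ := by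
        rw [← Real.rpow_add hpos]
        congr 1
        ring

theorem multiquadricHat_one_eq_fourier (α ξ : ℝ) :
    multiquadricHat α 1 ξ =
      FourierTransform.fourier (fun x : ℝ => (multiquadric α 1 x : ℂ)) (ξ / (2 * Real.pi)) := by
  rw [Real.fourier_real_eq_integral_exp_smul, multiquadricHat]
  congr 1 with x
  rw [smul_eq_mul, mul_comm]
  congr 2
  have : (Real.pi : ℂ) ≠ 0 := by exact_mod_cast Real.pi_ne_zero
  push_cast
  field_simp

theorem contDiff_multiquadricHat_one {α : ℝ} {n : ℕ} (hn : (n : ℝ) < 2 * -α - 1) :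
    ContDiff ℝ n (multiquadricHat α 1) := by
  have h : ContDiff ℝ (n : ℕ∞)
      (FourierTransform.fourier fun x : ℝ => (multiquadric α 1 x : ℂ)) :=
    Real.contDiff_fourier fun m hm => integrable_pow_mul_multiquadric
      (lt_of_le_of_lt (by exact_mod_cast hm) hn)
  rw [funext (multiquadricHat_one_eq_fourier α)]
  exact ContDiff.comp (g := FourierTransform.fourier fun x : ℝ => (multiquadric α 1 x : ℂ)) h
    (by fun_prop)

/-- Scaling reduces the transform to the shape parameter `1`. -/
theorem multiquadricHat_eq_scale (α ξ : ℝ) {c : ℝ} (hc : 0 < c) :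
    multiquadricHat α c ξ = ((c * c ^ (2 * α) : ℝ) : ℂ) * multiquadricHat α 1 (c * ξ) := by
  have h := Measure.integral_comp_mul_left
    (fun x : ℝ => (multiquadric α c x : ℂ) * Complex.exp (-(Complex.I * (ξ : ℂ) * (x : ℂ)))) c
  have hscale : ∀ x : ℝ, multiquadric α c (c * x) = c ^ (2 * α) * multiquadric α 1 x := fun x => by
    rw [multiquadric, multiquadric, Real.rpow_mul hc.le, Real.rpow_two,
      ← Real.mul_rpow (by positivity) (by positivity)]
    congr 1
    ring
  have hleft : ∫ x : ℝ, (multiquadric α c (c * x) : ℂ) *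
      Complex.exp (-(Complex.I * (ξ : ℂ) * ((c * x : ℝ) : ℂ))) =
      ((c ^ (2 * α) : ℝ) : ℂ) * multiquadricHat α 1 (c * ξ) := by
    rw [multiquadricHat, ← integral_const_mul]
    congr 1 with x
    rw [hscale]
    push_cast
    ring_nf
  rw [hleft, abs_of_pos (inv_pos.2 hc), ← multiquadricHat, Complex.real_smul] at h
  have hc' : (c : ℂ) ≠ 0 := by exact_mod_cast hc.ne'
  rw [Complex.ofReal_mul, mul_assoc, h]
  push_cast
  rw [mul_inv_cancel_left₀ hc']

theorem integral_gaussian_mul_exp {t : ℝ} (ht : 0 < t) (ξ : ℝ) :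
    ∫ x : ℝ, (Real.exp (-(t * x ^ 2)) : ℂ) * Complex.exp (-(Complex.I * ξ * x)) =
      ((Real.sqrt Real.pi * t ^ (-(1 / 2) : ℝ) * Real.exp (-(ξ ^ 2 / (4 * t))) : ℝ) : ℂ) := by
  have h := fourierIntegral_gaussian (b := (t : ℂ)) (by simpa using ht) (-(ξ : ℂ))
  have hroot : ((Real.pi : ℂ) / t) ^ (1 / 2 : ℂ) =
      ((Real.sqrt Real.pi * t ^ (-(1 / 2) : ℝ) : ℝ) : ℂ) := by
    rw [← Complex.ofReal_div, show (1 / 2 : ℂ) = ((1 / 2 : ℝ) : ℂ) by push_cast; ring,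
      ← Complex.ofReal_cpow (by positivity), Real.div_rpow Real.pi_pos.le ht.le,
      Real.rpow_neg ht.le, Real.sqrt_eq_rpow]
    rfl
  rw [Complex.ofReal_mul, ← hroot]
  rw [show ((Real.exp (-(ξ ^ 2 / (4 * t))) : ℝ) : ℂ) = Complex.exp (-(-(ξ : ℂ)) ^ 2 / (4 * t)) by
    push_cast
    congr 1
    ring, ← h]
  congr 1 with x
  rw [mul_comm]
  push_cast
  congr 2 <;> ring

/-- Writing `(x² + 1)^α` as a superposition of Gaussians by Euler's integral for `Γ(-α)` and
exchanging the integrals gives the transform as a positive multiple of a Bessel-type integral. -/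
theorem multiquadricHat_one_eq_besselIntegral {α : ℝ} (hα : α < -1) (ξ : ℝ) :
    multiquadricHat α 1 ξ =
      ((Real.sqrt Real.pi / Real.Gamma (-α) * besselIntegral (-α - 3 / 2) ξ : ℝ) : ℂ) := by
  have hΓ : 0 < Real.Gamma (-α) := Real.Gamma_pos_of_pos (by linarith)
  have heuler : ∀ x : ℝ, ∫ t in Ioi (0 : ℝ), t ^ (-α - 1) * Real.exp (-((x ^ 2 + 1) * t)) =
      multiquadric α 1 x * Real.Gamma (-α) := fun x => by
    have hx : 0 < x ^ 2 + 1 := by positivity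
    rw [Real.integral_rpow_mul_exp_neg_mul_Ioi (by linarith) hx, multiquadric, one_div,
      Real.inv_rpow hx.le, Real.rpow_neg hx.le, inv_inv, one_pow]
  let F : ℝ → ℝ → ℂ := fun x t =>
    ((t ^ (-α - 1) * Real.exp (-((x ^ 2 + 1) * t)) : ℝ) : ℂ) * Complex.exp (-(Complex.I * ξ * x))
  have hnexp : ∀ x : ℝ, ‖Complex.exp (-(Complex.I * ξ * x))‖ = 1 := fun x => by
    rw [Complex.norm_exp]
    simp
  have hFint : Integrable (Function.uncurry F) (volume.prod (volume.restrict (Ioi (0 : ℝ)))) := by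
    have hmeas : AEStronglyMeasurable (Function.uncurry F)
        (volume.prod (volume.restrict (Ioi (0 : ℝ)))) := by
      refine Measurable.aestronglyMeasurable ?_
      simp only [F, Function.uncurry_def]
      fun_prop
    rw [integrable_prod_iff hmeas]
    have hnorm : ∀ x : ℝ, ∫ t in Ioi (0 : ℝ), ‖F x t‖ = multiquadric α 1 x * Real.Gamma (-α) :=
      fun x => by
        rw [← heuler]
        refine setIntegral_congr_fun measurableSet_Ioi fun t ht => ?_
        have ht : 0 < t := ht
        simp only [F]
        rw [norm_mul, hnexp, mul_one, Complex.norm_real, Real.norm_of_nonneg (by positivity)]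
    refine ⟨.of_forall fun x => ?_, ?_⟩
    · simp only [Function.uncurry_apply_pair, F]
      have h : IntegrableOn (fun t : ℝ => t ^ (-α - 1) * Real.exp (-((x ^ 2 + 1) * t))) (Ioi 0) :=
        (integrableOn_rpow_mul_exp_neg_mul_rpow (p := 1) (s := -α - 1) (b := x ^ 2 + 1)
          (by linarith) one_pos (by positivity)).congr_fun
          (fun t _ => by simp only [Real.rpow_one, neg_mul])
          measurableSet_Ioi
      exact (Integrable.ofReal h).mul_const _
    · simp only [Function.uncurry_apply_pair, hnorm]
      have h := integrable_pow_mul_multiquadric (α := α) (n := 0) (by simp; linarith)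
      refine (h.mul_const (Real.Gamma (-α))).congr (.of_forall fun x => ?_)
      simp only [pow_zero, one_mul, Complex.norm_real]
      rw [Real.norm_of_nonneg (by unfold multiquadric; positivity)]
  have hswap := integral_integral_swap hFint
  have hleft : ∫ x : ℝ, ∫ t in Ioi (0 : ℝ), F x t =
      (Real.Gamma (-α) : ℂ) * multiquadricHat α 1 ξ := by
    rw [multiquadricHat, ← integral_const_mul]
    congr 1 with x
    simp only [F]
    rw [integral_mul_const, integral_complex_ofReal, heuler]
    push_cast
    ring
  have hright : ∫ t in Ioi (0 : ℝ), ∫ x : ℝ, F x t =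
      ((Real.sqrt Real.pi * besselIntegral (-α - 3 / 2) ξ : ℝ) : ℂ) := by
    rw [besselIntegral, ← integral_const_mul, ← integral_complex_ofReal]
    refine setIntegral_congr_fun measurableSet_Ioi fun t ht => ?_
    have ht : 0 < t := ht
    have hsplit : ∀ x : ℝ, F x t = ((t ^ (-α - 1) * Real.exp (-t) : ℝ) : ℂ) *
        ((Real.exp (-(t * x ^ 2)) : ℂ) * Complex.exp (-(Complex.I * ξ * x))) := fun x => by
      simp only [F]
      rw [show -((x ^ 2 + 1) * t) = -t + -(t * x ^ 2) by ring, Real.exp_add]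
      push_cast
      ring
    simp only [hsplit]
    rw [integral_const_mul, integral_gaussian_mul_exp ht, ← Complex.ofReal_mul]
    congr 1
    rw [show -α - 3 / 2 = -α - 1 + -(1 / 2) by ring, Real.rpow_add ht, sub_eq_add_neg (-t),
      Real.exp_add]
    ring
  rw [hleft, hright] at hswap
  have hΓ' : (Real.Gamma (-α) : ℂ) ≠ 0 := by exact_mod_cast hΓ.ne'
  have h := eq_div_of_mul_eq hΓ' ((mul_comm _ _).trans hswap)
  rw [h]
  push_cast
  ring

theorem contDiff_besselIntegral {α : ℝ} (hα : α < -1) {n : ℕ} (hn : (n : ℝ) < 2 * -α - 1) :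
    ContDiff ℝ n (besselIntegral (-α - 3 / 2)) := by
  have hΓ : 0 < Real.Gamma (-α) := Real.Gamma_pos_of_pos (by linarith)
  have hπ : 0 < Real.sqrt Real.pi := Real.sqrt_pos.2 Real.pi_pos
  have h : besselIntegral (-α - 3 / 2) = fun ξ =>
      Real.Gamma (-α) / Real.sqrt Real.pi * Complex.reCLM (multiquadricHat α 1 ξ) := by
    funext ξ
    rw [multiquadricHat_one_eq_besselIntegral hα, Complex.reCLM_apply, Complex.ofReal_re]
    field_simp
  rw [h]
  exact contDiff_const.mul (Complex.reCLM.contDiff.comp (contDiff_multiquadricHat_one hn))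

/-! ### The fundamental function -/

theorem exists_multiquadricHat_eq_mul_besselIntegral {α c : ℝ} (hα : α < -1) (hc : 0 < c) :
    ∃ κ : ℝ, 0 < κ ∧ ∀ ξ, multiquadricHat α c ξ =
      ((κ * besselIntegral (-α - 3 / 2) (c * ξ) : ℝ) : ℂ) := by
  have hΓ : 0 < Real.Gamma (-α) := Real.Gamma_pos_of_pos (by linarith)
  have hπ : 0 < Real.sqrt Real.pi := Real.sqrt_pos.2 Real.pi_pos
  refine ⟨c * c ^ (2 * α) * (Real.sqrt Real.pi / Real.Gamma (-α)), by positivity, fun ξ => ?_⟩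
  rw [multiquadricHat_eq_scale α ξ hc, multiquadricHat_one_eq_besselIntegral hα,
    ← Complex.ofReal_mul, mul_assoc (c * c ^ (2 * α))]

theorem continuous_besselIntegral {α : ℝ} (hα : α < -1) :
    Continuous (besselIntegral (-α - 3 / 2)) :=
  (contDiff_besselIntegral hα (n := 0) (by simp; linarith)).continuous

theorem summable_besselIntegral_translate {α : ℝ} (hα : α < -1) {P : ℝ} (hP : 0 < P) (y : ℝ) :
    Summable fun j : ℤ => besselIntegral (-α - 3 / 2) (y + P * j) := by
  have hB := contDiff_besselIntegral hα (n := 0) (by simp; linarith)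
  obtain ⟨C, hC⟩ := exists_derivsDominated_besselIntegral (by linarith) hB
  obtain ⟨D, hD, h⟩ := exists_besselIntegral_le_exp hB.continuous
  have hC0 : 0 ≤ C := by
    have h0 := (abs_nonneg _).trans (hC 0 le_rfl 0)
    exact nonneg_of_mul_nonneg_left h0 (besselIntegral_pos (by linarith) 0)
  simpa using hC.summable_translate hC0 hP h hD le_rfl y

theorem periodization_besselIntegral_pos {α : ℝ} (hα : α < -1) {P : ℝ} (hP : 0 < P) (y : ℝ) :
    0 < periodization P (besselIntegral (-α - 3 / 2)) y :=
  (summable_besselIntegral_translate hα hP y).tsum_pos (fun _ => besselIntegral_nonneg _ _) 0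
    (besselIntegral_pos (by linarith) _)

theorem hasSum_multiquadricHat {α c κ : ℝ} (hα : α < -1) (hc : 0 < c)
    (h : ∀ ξ, multiquadricHat α c ξ = ((κ * besselIntegral (-α - 3 / 2) (c * ξ) : ℝ) : ℂ))
    (ξ : ℝ) :
    HasSum (fun j : ℤ => multiquadricHat α c (ξ + 2 * Real.pi * (j : ℝ)))
      ((κ * periodization (c * (2 * Real.pi)) (besselIntegral (-α - 3 / 2)) (c * ξ) : ℝ) : ℂ) := by
  have hs := (summable_besselIntegral_translate hα
    (mul_pos hc Real.two_pi_pos) (c * ξ)).hasSum.mul_left κ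
  refine (Complex.hasSum_ofReal.2 hs).congr_fun fun j => ?_
  rw [h, mul_add, mul_assoc c]

theorem fundamentalHat_eq {α c : ℝ} (hα : α < -1) (hc : 0 < c) (ξ : ℝ) :
    fundamentalHat α c ξ = ((besselIntegral (-α - 3 / 2) (c * ξ) /
      periodization (c * (2 * Real.pi)) (besselIntegral (-α - 3 / 2)) (c * ξ) : ℝ) : ℂ) := by
  obtain ⟨κ, hκ, h⟩ := exists_multiquadricHat_eq_mul_besselIntegral hα hc
  rw [fundamentalHat, (hasSum_multiquadricHat hα hc h ξ).tsum_eq, h, ← Complex.ofReal_div,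
    mul_div_mul_left _ _ hκ.ne']

theorem lintegral_fundamentalHat {α c : ℝ} (hα : α < -1) (hc : 0 < c)
    (hS : Continuous (periodization (c * (2 * Real.pi)) (besselIntegral (-α - 3 / 2)))) :
    ∫⁻ ξ, ENNReal.ofReal (besselIntegral (-α - 3 / 2) (c * ξ) /
      periodization (c * (2 * Real.pi)) (besselIntegral (-α - 3 / 2)) (c * ξ)) =
      ENNReal.ofReal (2 * Real.pi) := by
  have hscale : ∀ ξ : ℝ, periodization (c * (2 * Real.pi)) (besselIntegral (-α - 3 / 2)) (c * ξ) =
      periodization (2 * Real.pi) (fun ξ => besselIntegral (-α - 3 / 2) (c * ξ)) ξ := fun ξ => by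
    simp only [periodization, mul_add, mul_assoc]
  rw [← lintegral_div_periodization Real.two_pi_pos
    (f := fun ξ => besselIntegral (-α - 3 / 2) (c * ξ))]
  · simp only [hscale]
  · exact (continuous_besselIntegral hα).comp (by fun_prop)
  · rw [← funext hscale]
    exact hS.comp (by fun_prop)
  · exact fun x => besselIntegral_pos (by linarith) _
  · intro y
    refine (summable_besselIntegral_translate hα (mul_pos hc Real.two_pi_pos) (c * y)).congr
      fun j => ?_
    rw [mul_add, mul_assoc c]

theorem norm_iteratedDeriv_ofReal_comp {n : ℕ} {f : ℝ → ℝ} (hf : ContDiff ℝ n f) (x : ℝ) :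
    ‖iteratedDeriv n (fun x => (f x : ℂ)) x‖ = |iteratedDeriv n f x| := by
  have h := Complex.ofRealLI.norm_iteratedFDeriv_comp_left (hf.contDiffAt (x := x)) (i := n) le_rfl
  rw [norm_iteratedFDeriv_eq_norm_iteratedDeriv, norm_iteratedFDeriv_eq_norm_iteratedDeriv] at h
  exact h

/-- The function `fundamentalHat α c` is the dilate by `c` of a quotient whose derivatives are
dominated by the quotient itself uniformly in `c`, and its own integral is `2π`. -/
theorem exists_eLpNorm_iteratedDeriv_fundamentalHat_le {α : ℝ} (hα : α < -1) {k : ℕ}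
    (hk : (k : ℝ) < 2 * -α - 1) :
    ∃ K, 0 ≤ K ∧ ∀ c, 0 < c → ContDiff ℝ k (fundamentalHat α c) ∧
      eLpNorm (iteratedDeriv k (fundamentalHat α c)) 1 volume ≤
        ENNReal.ofReal (K * c ^ k * (2 * Real.pi)) := by
  set B := besselIntegral (-α - 3 / 2)
  have hB : ContDiff ℝ k B := contDiff_besselIntegral hα hk
  have hB0 : ∀ x, 0 < B x := besselIntegral_pos (by linarith)
  obtain ⟨C, hC⟩ := exists_derivsDominated_besselIntegral (by linarith) hB
  obtain ⟨D, hD, hBD⟩ := exists_besselIntegral_le_exp hB.continuous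
  have hC0 : 0 ≤ C :=
    nonneg_of_mul_nonneg_left ((abs_nonneg _).trans (hC 0 (Nat.zero_le k) 0)) (hB0 0)
  obtain ⟨K, hK, hquot⟩ := DerivsDominated.exists_div k C
  refine ⟨K, hK, fun c hc => ?_⟩
  have hP : 0 < c * (2 * Real.pi) := mul_pos hc Real.two_pi_pos
  set S := periodization (c * (2 * Real.pi)) B
  have hS : ContDiff ℝ k S := hC.contDiff_periodization hC0 hP hB hBD hD
  have hS0 : ∀ x, 0 < S x := periodization_besselIntegral_pos hα hP
  have hH : ContDiff ℝ k fun y => B y / S y := hB.div hS fun y => (hS0 y).ne'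
  have hHK : DerivsDominated k K fun y => B y / S y :=
    hquot B S hB hS hB0 hS0 hC (hC.periodization hC0 hP hB hBD hD)
  have hdil : ContDiff ℝ k fun ξ => B (c * ξ) / S (c * ξ) :=
    hH.comp (contDiff_const.mul contDiff_id)
  have hL : fundamentalHat α c = fun ξ => ((B (c * ξ) / S (c * ξ) : ℝ) : ℂ) :=
    funext (fundamentalHat_eq hα hc)
  refine ⟨hL ▸ Complex.ofRealCLM.contDiff.comp hdil, ?_⟩
  rw [eLpNorm_one_eq_lintegral_enorm]
  calc ∫⁻ ξ, ‖iteratedDeriv k (fundamentalHat α c) ξ‖ₑ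
      ≤ ∫⁻ ξ, ENNReal.ofReal (K * c ^ k) * ENNReal.ofReal (B (c * ξ) / S (c * ξ)) := by
        refine lintegral_mono fun ξ => ?_
        rw [← ofReal_norm, hL, norm_iteratedDeriv_ofReal_comp hdil,
          ← ENNReal.ofReal_mul (by positivity)]
        refine ENNReal.ofReal_le_ofReal ?_
        have h := congrFun (iteratedDeriv_comp_const_mul hH c) ξ
        rw [h, abs_mul, abs_of_nonneg (by positivity)]
        calc c ^ k * |iteratedDeriv k (fun y => B y / S y) (c * ξ)|
            ≤ c ^ k * (K * (B (c * ξ) / S (c * ξ))) := by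
              gcongr
              exact hHK k le_rfl (c * ξ)
          _ = _ := by ring
    _ = ENNReal.ofReal (K * c ^ k * (2 * Real.pi)) := by
        rw [lintegral_const_mul' _ _ ENNReal.ofReal_ne_top,
          lintegral_fundamentalHat hα hc hS.continuous, ← ENNReal.ofReal_mul (by positivity)]

theorem fundamentalFunction_eq_fourier (α c x : ℝ) :
    fundamentalFunction α c x = 1 / (2 * (Real.pi : ℂ)) *
      FourierTransform.fourier (fundamentalHat α c) (-(x / (2 * Real.pi))) := by
  rw [fundamentalFunction, Real.fourier_real_eq_integral_exp_smul]
  congr 2 with ξ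
  rw [smul_eq_mul, mul_comm]
  congr 2
  have : (Real.pi : ℂ) ≠ 0 := by exact_mod_cast Real.pi_ne_zero
  push_cast
  field_simp

/-- Integration by parts: `|x|^n |L(x)|` is at most `(2π)⁻¹` times the `L¹` norm of the `n`-th
derivative of the transform. -/
theorem exists_norm_fundamentalFunction_le {α c : ℝ} (hα : α < -1) (hc : 0 < c) {n : ℕ}
    (hn : (n : ℝ) < 2 * -α - 1) :
    ∃ M, ∀ x, |x| ^ n * ‖fundamentalFunction α c x‖ ≤ M := by
  have hint : ∀ m : ℕ, (m : ℕ∞) ≤ n → Integrable (iteratedDeriv m (fundamentalHat α c)) :=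
    fun m hm => by
      have hm' : m ≤ n := by exact_mod_cast hm
      obtain ⟨K, -, h⟩ := exists_eLpNorm_iteratedDeriv_fundamentalHat_le hα (k := m)
        (lt_of_le_of_lt (by exact_mod_cast hm') hn)
      rw [← memLp_one_iff_integrable]
      exact ⟨((h c hc).1.continuous_iteratedDeriv m le_rfl).aestronglyMeasurable,
        (h c hc).2.trans_lt ENNReal.ofReal_lt_top⟩
  obtain ⟨_, _, hcd⟩ := exists_eLpNorm_iteratedDeriv_fundamentalHat_le hα hn
  have hF := Real.fourier_iteratedDeriv (N := n) (n := n) (hcd c hc).1 hint le_rfl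
  have hπ := Real.pi_pos
  refine ⟨1 / (2 * Real.pi) * ∫ ξ, ‖iteratedDeriv n (fundamentalHat α c) ξ‖, fun x => ?_⟩
  have hle : ‖FourierTransform.fourier (iteratedDeriv n (fundamentalHat α c))
      (-(x / (2 * Real.pi)))‖ ≤ ∫ ξ, ‖iteratedDeriv n (fundamentalHat α c) ξ‖ :=
    VectorFourier.norm_fourierIntegral_le_integral_norm _ _ _ _ _
  have hfac : ‖2 * (Real.pi : ℂ) * Complex.I * ((-(x / (2 * Real.pi)) : ℝ) : ℂ)‖ = |x| := by
    rw [norm_mul, norm_mul, norm_mul, Complex.norm_I, Complex.norm_real, Complex.norm_real,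
      Complex.norm_two, Real.norm_of_nonneg hπ.le, norm_neg, norm_div, Real.norm_eq_abs,
      Real.norm_of_nonneg (by positivity)]
    field_simp
  rw [hF, norm_smul, norm_pow, hfac] at hle
  have hconst : ‖(1 / (2 * (Real.pi : ℂ)))‖ = 1 / (2 * Real.pi) := by
    rw [norm_div, norm_one, norm_mul, Complex.norm_two, Complex.norm_real,
      Real.norm_of_nonneg hπ.le]
  rw [fundamentalFunction_eq_fourier, norm_mul, hconst, mul_left_comm]
  gcongr

theorem mainTheorem4 (α : ℝ) (hα : α < -1) :
    -- the series in the denominator converges to a nonzero value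
    (∀ c : ℝ, 1 ≤ c → ∀ ξ : ℝ,
      Summable (fun j : ℤ => multiquadricHat α c (ξ + 2 * Real.pi * (j : ℝ))) ∧
      (∑' j : ℤ, multiquadricHat α c (ξ + 2 * Real.pi * (j : ℝ))) ≠ 0) ∧
    -- the bound for the derivatives, with a constant that depends on `α` and `k` only
    (∀ k : ℕ, (k : ℝ) < 2 * |α| - 1 →
      ∃ A : ℝ, 0 < A ∧ ∀ c : ℝ, 1 ≤ c →
        ContDiff ℝ (k : ℕ∞) (fundamentalHat α c) ∧
        eLpNorm (iteratedDeriv k (fundamentalHat α c)) 1 volume ≤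
          ENNReal.ofReal
            (A * c ^ ((2 * (k : ℝ) + 1) * (2 * |α| - (⌊|α|⌋ : ℝ) - 1) + (k : ℝ)))) ∧
    -- the decay of the fundamental function as `|x| → ∞`
    (∀ c : ℝ, 1 ≤ c →
      fundamentalFunction α c =O[cocompact ℝ] fun x : ℝ => |x| ^ (-⌈2 * |α| - 2⌉)) := by
  have habs : |α| = -α := abs_of_neg (by linarith)
  rw [habs]
  refine ⟨fun c hc ξ => ?_, fun k hk => ?_, fun c hc => ?_⟩
  · have hc0 : 0 < c := by linarith
    obtain ⟨κ, hκ, h⟩ := exists_multiquadricHat_eq_mul_besselIntegral hα hc0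
    have hsum := hasSum_multiquadricHat hα hc0 h ξ
    refine ⟨hsum.summable, ?_⟩
    rw [hsum.tsum_eq, Complex.ofReal_ne_zero]
    exact (mul_pos hκ (periodization_besselIntegral_pos hα (mul_pos hc0 Real.two_pi_pos) _)).ne'
  · obtain ⟨K, hK, h⟩ := exists_eLpNorm_iteratedDeriv_fundamentalHat_le hα hk
    have hπ := Real.pi_pos
    refine ⟨(K + 1) * (2 * Real.pi), by positivity, fun c hc => ?_⟩
    have hc0 : 0 < c := by linarith
    refine ⟨(h c hc0).1, (h c hc0).2.trans (ENNReal.ofReal_le_ofReal ?_)⟩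
    -- The estimate holds with the smaller power `c ^ k`, as `⌊-α⌋ ≤ -α` and `1 < -α`.
    have hpow : c ^ k ≤ c ^ ((2 * (k : ℝ) + 1) * (2 * -α - (⌊-α⌋ : ℝ) - 1) + (k : ℝ)) := by
      rw [← Real.rpow_natCast]
      refine Real.rpow_le_rpow_of_exponent_le hc (le_add_of_nonneg_left ?_)
      have := Int.floor_le (-α)
      exact mul_nonneg (by positivity) (by linarith)
    calc K * c ^ k * (2 * Real.pi) ≤ (K + 1) * c ^ k * (2 * Real.pi) := by gcongr; linarith
      _ = (K + 1) * (2 * Real.pi) * c ^ k := by ring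
      _ ≤ _ := by gcongr
  · obtain ⟨n, hn⟩ := Int.eq_ofNat_of_zero_le
      (Int.ceil_nonneg (show (0 : ℝ) ≤ 2 * -α - 2 by linarith))
    have hlt : (n : ℝ) < 2 * -α - 1 := by
      have := Int.ceil_lt_add_one (2 * -α - 2)
      rw [hn] at this
      push_cast at this
      linarith
    obtain ⟨M, hM⟩ := exists_norm_fundamentalFunction_le hα (by linarith : 0 < c) hlt
    rw [hn]
    refine IsBigO.of_bound M ?_
    filter_upwards [(isCompact_singleton (x := (0 : ℝ))).compl_mem_cocompact] with x hx
    have hx0 : 0 < |x| := abs_pos.2 hx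
    rw [zpow_neg, zpow_natCast, Real.norm_of_nonneg (by positivity), ← div_eq_mul_inv,
      le_div_iff₀ (by positivity), mul_comm]
    exact hM x
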